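/- Let $\mathcal{R} = \langle R; +, <, \ldots\rangle$ be an expansion of an ordered Abelian group. Suppose that $\mathcal{R}$ is definably complete, that is, every nonempty definable subset of $R$ with an upper bound in $R$ has a least upper bound in $R$ ("definable" means definable by a first-order formula, possibly with parameters). Suppose also that the complete theory $T$ of $\mathcal{R}$ is strong: $T$ has no inp-pattern of infinite depth. That is, there are no finite tuple of variables $\overline{x}$, formulas $\varphi_i(\overline{x};\overline{y}_i)$, positive integers $k_i$ ($i<\omega$) and tuples $\overline{a}_{i,j}$ ($i,j<\omega$) from a model of $T$ such that, for each $i$, any $k_i$ of the formulas $\varphi_i(\overline{x};\overline{a}_{i,j})$, $j<\omega$ (taken at distinct indices $j$), are jointly inconsistent, while for each $\eta:\omega\to\omega$ the partial type $\{\varphi_i(\overline{x};\overline{a}_{i,\eta(i)}) : i<\omega\}$ is consistent. Let $D\subseteq R$ be a definable set which is discrete in the order topology. For $a \in D$ put $S_D(a)=\min\{b\in D: b>a\}$ and $S_D^{-1}(a)=\max\{b\in D: b<a\}$, whenever these exist, and let $$\mathcal{Z}(a)=\{S_D^n(a): n\in\mathbb{Z},\ S_D^n(a)\text{ exists}\}$$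 be the $\mathbb{Z}$-chain of $a$. Let $\mathcal{Z}(a)'\subseteq R^{>0}$ be the set of differences $c-b$, where $b, c\in\mathcal{Z}(a)$ and $c$ is the least element of $\mathcal{Z}(a)$ greater than $b$. Call positive $x,y\in R$ Archimedean equivalent if $x<ny$ and $y<nx$ for some $n\in\mathbb{N}$; the equivalence classes are the Archimedean classes. Then for every $a\in D$, only finitely many Archimedean classes are represented by elements of $\mathcal{Z}(a)'$. -/

import Mathlib

open FirstOrder

universe u v w

namespace StrongOAG

section ModelTheory

variable {L : FirstOrder.Language.{u, v}}

/-- The `L`-structure `R` is an expansion of the ordered Abelian group `R`: the language has a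
binary function symbol interpreted as `+` and a binary relation symbol interpreted as `<`. -/
def IsExpansion (L : FirstOrder.Language.{u, v}) (R : Type w) [Add R] [LT R]
    [L.Structure R] : Prop :=
  (∃ f : L.Functions 2, ∀ x y : R, Language.Structure.funMap f ![x, y] = x + y) ∧
  (∃ r : L.Relations 2, ∀ x y : R, Language.Structure.RelMap r ![x, y] ↔ x < y)

/-- Every nonempty subset of `R` that is definable with parameters and bounded above has a least
upper bound in `R`. -/
def DefinablyComplete (L : FirstOrder.Language.{u, v}) (R : Type w) [LE R]
    [L.Structure R] : Prop :=
  ∀ X : Set R, (Set.univ : Set R).Definable₁ L X → X.Nonempty → BddAbove X → ∃ s, IsLUB X s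

/-- An inp-pattern whose rows are indexed by `ι`, in the free variables `x₁, …, xₙ`, with
parameters from `M`. -/
structure InpPattern (L : FirstOrder.Language.{u, v}) (M : Type w) [L.Structure M]
    (ι : Type) (n : ℕ) where
  /-- the length of the tuple of parameter variables of row `i` -/
  m : ι → ℕ
  /-- the formula `φᵢ(x; y)` of row `i` -/
  φ : ∀ i, L.Formula (Fin n ⊕ Fin (m i))
  /-- the degree of inconsistency of row `i` -/
  k : ι → ℕ
  k_pos : ∀ i, 0 < k i
  /-- the parameters -/
  a : ∀ i, ℕ → Fin (m i) → M
  /-- row `i` is `kᵢ`-inconsistent -/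
  row_inconsistent : ∀ i, ∀ J : Finset ℕ, J.card = k i →
    ¬ ∃ x : Fin n → M, ∀ j ∈ J, (φ i).Realize (Sum.elim x (a i j))
  /-- each path is consistent, that is, finitely satisfiable in `M` -/
  path_consistent : ∀ η : ι → ℕ, ∀ F : Finset ι,
    ∃ x : Fin n → M, ∀ i ∈ F, (φ i).Realize (Sum.elim x (a i (η i)))

/-- A theory is strong if it has no inp-pattern of infinite depth, in any finite tuple of free
variables and with parameters from any model. Models are taken in a universe `w`; every
`w` above the universes of the language gives the same notion, by Löwenheim–Skolem. -/
def IsStrong (T : L.Theory) : Prop :=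
  ∀ (M : Type w) [L.Structure M] [Nonempty M] [M ⊨ T] (n : ℕ), IsEmpty (InpPattern L M ℕ n)

end ModelTheory

section Chains

variable {R : Type w}

/-- `b = S_D(a)`: `b` is the least element of `D` above `a`. -/
def IsNext [LinearOrder R] (D : Set R) (a b : R) : Prop :=
  IsLeast {c | c ∈ D ∧ a < c} b

/-- `b = S_D⁻¹(a)`: `b` is the greatest element of `D` below `a`. -/
def IsPrev [LinearOrder R] (D : Set R) (a b : R) : Prop :=
  IsGreatest {c | c ∈ D ∧ c < a} b

/-- The `ℤ`-chain of `a` in `D`: the points reached from `a` by finitely many (possibly zero)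
successor steps in `D`, or by finitely many predecessor steps in `D`. -/
def zChain [LinearOrder R] (D : Set R) (a : R) : Set R :=
  {b | Relation.ReflTransGen (IsNext D) a b ∨ Relation.ReflTransGen (IsPrev D) a b}

/-- The set `X'` of differences `S_X(b) - b` of successive elements of `X`. -/
def differenceSet [AddCommGroup R] [LinearOrder R] (X : Set R) : Set R :=
  {d | ∃ b ∈ X, ∃ c, IsNext X b c ∧ d = c - b}

end Chains

end StrongOAG

/-! Between two points of a `ℤ`-chain lie only finitely many points of `D`, so the set `Q` of
positive differences of `D ∩ [l, h]` is finite and definable from `l`, `h` and the parameters of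
`D`. If the chain had infinitely many Archimedean classes of gaps, a suitable interval would exhibit
any given number of classes in `Q`. Taking the greatest element of `Q` in each of `N * N` classes
gives a rapidly decreasing sequence, which is cut into `N` blocks of length `N`. A sum of one term
from each block has these terms as the digits of its greedy expansion over `Q` (`isDigit_sum`).
Hence the formulas "the `t`-th digit of `x` is `c`", with `c` ranging over the `t`-th block, form a
pattern of depth and width `N`: rows are 2-inconsistent because digits are unique, and paths are
realized by the sums. The formulas do not depend on `N`, since `l` and `h` enter as parameters, so
an ultraproduct turns these finite patterns into one of infinite depth
(`IsStrong.not_uniform_patterns`). -/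

namespace StrongOAG

/-! ### From finite patterns to an infinite one. -/

section Ultraproduct

open Filter FirstOrder.Language

variable {L : FirstOrder.Language.{u, v}}

/-- A strong complete theory has no family of formulas which, for every `N`, forms the rows of an
inconsistency pattern of depth and width `N` in the given structure. -/
theorem IsStrong.not_uniform_patterns {R : Type w} [L.Structure R] [Nonempty R]
    (hstrong : IsStrong.{u, v, max u v w} (L.completeTheory R)) {n m : ℕ}
    (φ : ℕ → L.Formula (Fin n ⊕ Fin m)) (c : ℕ → ℕ → ℕ → Fin m → R)
    (hrow : ∀ N t j j', t < N → j < N → j' < N → j ≠ j' →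
      ¬ ∃ x : Fin n → R, (φ t).Realize (Sum.elim x (c N t j)) ∧
        (φ t).Realize (Sum.elim x (c N t j')))
    (hpath : ∀ (N : ℕ) (η : ℕ → ℕ), ∃ x : Fin n → R, ∀ t < N,
      (φ t).Realize (Sum.elim x (c N t (η t)))) : False := by
  let U := (hyperfilter ℕ : Filter ℕ).Product (fun _ => R)
  have hev : ∀ k : ℕ, ∀ᶠ N in (hyperfilter ℕ : Filter ℕ), k < N := fun k =>
    (Nat.hyperfilter_le_atTop) (eventually_gt_atTop k)
  have hequiv : R ≅[L] U := by
    rw [elementarilyEquivalent_iff]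
    intro σ
    rw [Ultraproduct.sentence_realize, eventually_const]
  have : U ⊨ L.completeTheory R := hequiv.theory_model
  have : Nonempty U := Ultraproduct.Product.instNonempty
  -- `U` lives in universe `w`, whereas strongness is assumed for models in `max u v w`.
  let e : U ≃ ULift.{max u v} U := Equiv.ulift.symm
  let _ : L.Structure (ULift.{max u v} U) := e.inducedStructure
  let E : U ≃[L] ULift.{max u v} U := e.inducedStructureEquiv
  have : ULift.{max u v} U ⊨ L.completeTheory R := StrongHomClass.theory_model E
  -- Łoś's theorem, transported along the lift.
  have hreal : ∀ (t : ℕ) (x : Fin n → ℕ → R) (a : Fin m → ℕ → R),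
      (φ t).Realize (Sum.elim (fun i => e ((x i : ℕ → R) : U)) fun i => e ((a i : ℕ → R) : U)) ↔
        ∀ᶠ N in (hyperfilter ℕ : Filter ℕ),
          (φ t).Realize (Sum.elim (fun i => x i N) fun i => a i N) := by
    intro t x a
    have h1 := StrongHomClass.realize_formula E (φ t)
      (v := fun i => ((Sum.elim x a i : ℕ → R) : U))
    have h2 := Ultraproduct.realize_formula_cast (u := hyperfilter ℕ) (φ t) (Sum.elim x a)
    have h3 : (E ∘ fun i => ((Sum.elim x a i : ℕ → R) : U)) =
        Sum.elim (fun i => e ((x i : ℕ → R) : U)) fun i => e ((a i : ℕ → R) : U) := by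
      funext i
      cases i <;> rfl
    have h4 : ∀ N, (fun i => Sum.elim x a i N) =
        Sum.elim (fun i => x i N) fun i => a i N := by
      intro N
      funext i
      cases i <;> rfl
    simp only [h4] at h2
    exact (h3 ▸ h1).trans h2
  have P : InpPattern L (ULift.{max u v} U) ℕ n :=
    { m := fun _ => m
      φ := φ
      k := fun _ => 2
      k_pos := fun _ => two_pos
      a := fun t j i => e (((fun N => c N t j i : ℕ → R)) : U)
      row_inconsistent := by
        rintro t J hJ ⟨x, hx⟩
        obtain ⟨j, j', hne, rfl⟩ := Finset.card_eq_two.1 hJ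
        obtain ⟨y, hy⟩ : ∃ y : Fin n → ℕ → R, x = fun i => e ((y i : ℕ → R) : U) := by
          have : ∀ i, ∃ y : ℕ → R, x i = e ((y : ℕ → R) : U) := by
            intro i
            obtain ⟨y, hy⟩ := Quotient.exists_rep (e.symm (x i))
            exact ⟨y, (e.symm_apply_eq.1 hy.symm)⟩
          choose y hy using this
          exact ⟨y, funext hy⟩
        subst hy
        have h1 := (hreal t y _).1 (hx j (by simp))
        have h2 := (hreal t y _).1 (hx j' (by simp))
        obtain ⟨N, ⟨⟨h1, h2⟩, ht⟩, hj, hj'⟩ :=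
          (((h1.and h2).and (hev t)).and ((hev j).and (hev j'))).exists
        exact hrow N t j j' ht hj hj' hne ⟨_, h1, h2⟩
      path_consistent := by
        intro η F
        -- The class of `N ↦ x N` satisfies every row of the path at once, as row `t` holds for all
        -- `N > t`.
        choose x hx using fun N => hpath N η
        refine ⟨fun i => e (((fun N => x N i : ℕ → R)) : U), fun t _ => ?_⟩
        refine (hreal t _ _).2 ?_
        filter_upwards [hev t] with N hN
        exact hx N t hN }
  exact (hstrong (ULift.{max u v} U) n).false P

end Ultraproduct

/-! ### Closure properties of parameter-free definability. -/

section Definability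

open FirstOrder.Language

variable {L : FirstOrder.Language.{u, v}} {R : Type w} [L.Structure R]

/-- The predicate `p` on tuples is defined by a formula without parameters. -/
def FormulaDefinable (L : FirstOrder.Language.{u, v}) {R : Type w} [L.Structure R] {ι : Type}
    (p : (ι → R) → Prop) : Prop :=
  ∃ φ : L.Formula ι, ∀ v, φ.Realize v ↔ p v

namespace FormulaDefinable

variable {ι : Type}

theorem and {p q : (ι → R) → Prop} (hp : FormulaDefinable L p) (hq : FormulaDefinable L q) :
    FormulaDefinable L fun v => p v ∧ q v := by
  obtain ⟨φ, hφ⟩ := hp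
  obtain ⟨ψ, hψ⟩ := hq
  exact ⟨φ ⊓ ψ, fun v => by rw [Formula.realize_inf, hφ, hψ]⟩

theorem not {p : (ι → R) → Prop} (hp : FormulaDefinable L p) :
    FormulaDefinable L fun v => ¬ p v := by
  obtain ⟨φ, hφ⟩ := hp
  exact ⟨φ.not, fun v => by rw [Formula.realize_not, hφ]⟩

theorem ex {p : (ι → R) → R → Prop}
    (hp : FormulaDefinable L fun v : ι ⊕ Unit → R => p (fun i => v (.inl i)) (v (.inr ()))) :
    FormulaDefinable L fun v => ∃ x, p v x := by
  obtain ⟨φ, hφ⟩ := hp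
  refine ⟨φ.iExs Unit, fun v => ?_⟩
  rw [Formula.realize_iExs]
  constructor
  · rintro ⟨i, hi⟩
    exact ⟨i (), (hφ _).1 hi⟩
  · rintro ⟨x, hx⟩
    exact ⟨fun _ => x, (hφ _).2 hx⟩

theorem all {p : (ι → R) → R → Prop}
    (hp : FormulaDefinable L fun v : ι ⊕ Unit → R => p (fun i => v (.inl i)) (v (.inr ()))) :
    FormulaDefinable L fun v => ∀ x, p v x := by
  have h := (ex (p := fun v x => ¬ p v x) hp.not).not
  simpa only [not_exists, not_not] using h

theorem imp {p q : (ι → R) → Prop} (hp : FormulaDefinable L p) (hq : FormulaDefinable L q) :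
    FormulaDefinable L fun v => p v → q v := by
  obtain ⟨φ, hφ⟩ := hp
  obtain ⟨ψ, hψ⟩ := hq
  exact ⟨φ.imp ψ, fun v => by rw [Formula.realize_imp, hφ, hψ]⟩

theorem comp {κ : Type} {p : (κ → R) → Prop} (hp : FormulaDefinable L p) (f : κ → ι) :
    FormulaDefinable L fun v : ι → R => p (v ∘ f) := by
  obtain ⟨φ, hφ⟩ := hp
  exact ⟨φ.relabel f, fun v => by rw [Formula.realize_relabel, hφ]⟩

end FormulaDefinable

namespace IsExpansion

variable {ι : Type}

theorem formulaDefinable_add_eq [Add R] [LT R] (h : IsExpansion L R) (i j k : ι) :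
    FormulaDefinable L fun v : ι → R => v i + v j = v k := by
  obtain ⟨⟨f, hf⟩, -⟩ := h
  exact ⟨(f.apply₂ (Term.var i) (Term.var j)).equal (Term.var k), fun v => by
    simp [Formula.realize_equal, Term.realize_functions_apply₂, hf]⟩

theorem formulaDefinable_lt [Add R] [LT R] (h : IsExpansion L R) (i j : ι) :
    FormulaDefinable L fun v : ι → R => v i < v j := by
  obtain ⟨-, r, hr⟩ := h
  exact ⟨r.formula₂ (Term.var i) (Term.var j), fun v => by
    simp [Formula.realize_rel₂, hr]⟩

theorem formulaDefinable_le [Add R] [LinearOrder R] (h : IsExpansion L R) (i j : ι) :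
    FormulaDefinable L fun v : ι → R => v i ≤ v j := by
  simpa only [not_lt] using (h.formulaDefinable_lt j i).not

end IsExpansion

/-- A subset of `R` definable with parameters is a fibre of a relation definable without
parameters. -/
theorem exists_formulaDefinable_fibre {D : Set R} (hD : (Set.univ : Set R).Definable₁ L D) :
    ∃ (n : ℕ) (p : Fin n → R) (S : (Fin n → R) → R → Prop),
      (FormulaDefinable L fun v : Fin n ⊕ Unit → R => S (fun i => v (.inl i)) (v (.inr ()))) ∧
        ∀ x, x ∈ D ↔ S p x := by
  obtain ⟨A, -, hA⟩ := Set.definable_iff_finitely_definable.1 hD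
  obtain ⟨φ, hφ⟩ := Set.definable_iff_exists_formula_sum.1 hA
  let e : ((A : Set R) : Type w) ≃ Fin A.card := A.equivFin
  refine ⟨A.card, fun i => (e.symm i : R),
    fun p x => φ.Realize (Sum.elim (fun a => p (e a)) fun _ => x), ?_, fun x => ?_⟩
  · refine ⟨φ.relabel (Sum.map e fun _ => ()), fun v => ?_⟩
    rw [Formula.realize_relabel]
    have : v ∘ Sum.map e (fun _ : Fin 1 => ()) =
        Sum.elim (fun a => v (.inl (e a))) fun _ => v (.inr ()) := by
      funext i
      cases i <;> rfl
    rw [this]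
  · have h : ((fun _ => x) : Fin 1 → R) ∈ {v : Fin 1 → R | v 0 ∈ D} ↔ x ∈ D := Iff.rfl
    rw [← h, hφ]
    simp

end Definability

/-! ### Greedy expansions and their definability. -/

section Digits

variable {R : Type w} [AddCommGroup R] [LinearOrder R]

/-- The positive differences of elements of `D ∩ [l, h]`. -/
def intervalDifferences (D : Set R) (l h : R) : Set R :=
  {q | ∃ b, (b ∈ D ∧ l ≤ b) ∧ ∃ c, (c ∈ D ∧ c ≤ h) ∧ b < c ∧ b + q = c}

/-- `c` is the `t`-th digit of `x` in the greedy expansion of `x` as a sum of elements of `Q`. -/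
def IsDigit (Q : Set R) : ℕ → R → R → Prop
  | 0, x, c => (c ∈ Q ∧ c ≤ x) ∧ ∀ q, (q ∈ Q ∧ q ≤ x) → q ≤ c
  | t + 1, x, c => ∃ q, ((q ∈ Q ∧ q ≤ x) ∧ ∀ q', (q' ∈ Q ∧ q' ≤ x) → q' ≤ q) ∧
      ∃ y, q + y = x ∧ IsDigit Q t y c

theorem IsDigit.unique {Q : Set R} {t : ℕ} {x c c' : R} (h : IsDigit Q t x c)
    (h' : IsDigit Q t x c') : c = c' := by
  induction t generalizing x with
  | zero => exact le_antisymm (h'.2 _ h.1) (h.2 _ h'.1)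
  | succ t ih =>
    obtain ⟨q, hq, y, rfl, hy⟩ := h
    obtain ⟨q', hq', y', hyy, hy'⟩ := h'
    obtain rfl : q = q' := le_antisymm (hq'.2 _ hq.1) (hq.2 _ hq'.1)
    obtain rfl : y' = y := add_left_cancel hyy
    exact ih hy hy'

/-- Since each term is at most half of the preceding one, the terms after `m 0` add up to at most `m
0`. The sum thus lies between `m 0` and `2 • m 0`, and `hmax` leaves no element of `Q` in the
half-open interval `(m 0, 2 • m 0]`. So the greedy choice is `m 0`, and the remainder has the same
form. -/
theorem isDigit_sum [IsOrderedAddMonoid R] {Q : Set R} {N : ℕ} {m : ℕ → R}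
    (hpos : ∀ i < N, 0 < m i) (hmem : ∀ i < N, m i ∈ Q)
    (hmax : ∀ i < N, ∀ q ∈ Q, q ≤ m i ∨ 2 • m i < q)
    (hdec : ∀ i, i + 1 < N → 2 • m (i + 1) ≤ m i) {t : ℕ} (ht : t < N) :
    IsDigit Q t (∑ i ∈ Finset.range N, m i) (m t) := by
  induction N generalizing m t with
  | zero => omega
  | succ N ih =>
    have key : ∀ (N : ℕ) (m : ℕ → R), (∀ i < N + 1, 0 < m i) →
        (∀ i, i + 1 < N + 1 → 2 • m (i + 1) ≤ m i) →
        0 ≤ ∑ i ∈ Finset.range N, m (i + 1) ∧ ∑ i ∈ Finset.range N, m (i + 1) ≤ m 0 := by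
      intro N
      induction N with
      | zero => intro m hpos _; simpa using (hpos 0 (by omega)).le
      | succ N ih =>
        intro m hpos hdec
        obtain ⟨h1, h2⟩ := ih (fun i => m (i + 1)) (fun i hi => hpos _ (by omega))
          (fun i hi => hdec _ (by omega))
        have h3 := hdec 0 (by omega)
        have h4 := hpos 1 (by omega)
        rw [Finset.sum_range_succ']
        refine ⟨add_nonneg h1 h4.le, le_trans ?_ h3⟩
        rw [two_nsmul]
        gcongr
    obtain ⟨h0, h1⟩ := key N m hpos hdec
    rw [Finset.sum_range_succ', add_comm]
    have hfloor : (m 0 ∈ Q ∧ m 0 ≤ m 0 + ∑ i ∈ Finset.range N, m (i + 1)) ∧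
        ∀ q, (q ∈ Q ∧ q ≤ m 0 + ∑ i ∈ Finset.range N, m (i + 1)) → q ≤ m 0 := by
      refine ⟨⟨hmem 0 (by omega), le_add_of_nonneg_right h0⟩, fun q hq => ?_⟩
      refine (hmax 0 (by omega) q hq.1).resolve_right fun h => ?_
      have : q ≤ 2 • m 0 := hq.2.trans (by rw [two_nsmul]; gcongr)
      exact absurd h this.not_gt
    cases t with
    | zero => exact hfloor
    | succ t =>
      exact ⟨m 0, hfloor, _, rfl, ih (m := fun i => m (i + 1)) (fun i hi => hpos _ (by omega))
        (fun i hi => hmem _ (by omega)) (fun i hi => hmax _ (by omega))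
        (fun i hi => hdec _ (by omega)) (by omega)⟩

-- The variable type `ι` is quantified after `t` because each quantifier of the recursion adjoins a
-- variable.
open FirstOrder.Language in
theorem formulaDefinable_isDigit {L : FirstOrder.Language.{u, v}} [L.Structure R]
    (hexp : IsExpansion L R) {n : ℕ} {S : (Fin n → R) → R → Prop}
    (hS : FormulaDefinable L fun v : Fin n ⊕ Unit → R => S (fun i => v (.inl i)) (v (.inr ())))
    (t : ℕ) : ∀ {ι : Type} (e : Fin n → ι) (l h x c : ι),
      FormulaDefinable L fun v : ι → R =>
        IsDigit (intervalDifferences {y | S (fun i => v (e i)) y} (v l) (v h)) t (v x) (v c) := by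
  have hD : ∀ {ι : Type} (e : Fin n → ι) (x : ι),
      FormulaDefinable L fun v : ι → R => v x ∈ {y | S (fun i => v (e i)) y} :=
    fun e x => hS.comp (Sum.elim e fun _ => x)
  have hQ : ∀ {ι : Type} (e : Fin n → ι) (l h q : ι), FormulaDefinable L fun v : ι → R =>
      v q ∈ intervalDifferences {y | S (fun i => v (e i)) y} (v l) (v h) := by
    intro ι e l h q
    refine .ex (.and (.and ?_ ?_) (.ex (.and (.and ?_ ?_) (.and ?_ ?_))))
    · exact hD (fun i => Sum.inl (e i)) (Sum.inr ())
    · exact hexp.formulaDefinable_le (Sum.inl l) (Sum.inr ())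
    · exact hD (fun i => Sum.inl (Sum.inl (e i))) (Sum.inr ())
    · exact hexp.formulaDefinable_le (Sum.inr ()) (Sum.inl (Sum.inl h))
    · exact hexp.formulaDefinable_lt (Sum.inl (Sum.inr ())) (Sum.inr ())
    · exact hexp.formulaDefinable_add_eq (Sum.inl (Sum.inr ())) (Sum.inl (Sum.inl q)) (Sum.inr ())
  have hfloor : ∀ {ι : Type} (e : Fin n → ι) (l h x c : ι), FormulaDefinable L fun v : ι → R =>
      (v c ∈ intervalDifferences {y | S (fun i => v (e i)) y} (v l) (v h) ∧ v c ≤ v x) ∧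
      ∀ q, (q ∈ intervalDifferences {y | S (fun i => v (e i)) y} (v l) (v h) ∧ q ≤ v x) →
        q ≤ v c := by
    intro ι e l h x c
    refine .and (.and ?_ ?_) (.all (.imp (.and ?_ ?_) ?_))
    · exact hQ e l h c
    · exact hexp.formulaDefinable_le c x
    · exact hQ (fun i => Sum.inl (e i)) (Sum.inl l) (Sum.inl h) (Sum.inr ())
    · exact hexp.formulaDefinable_le (Sum.inr ()) (Sum.inl x)
    · exact hexp.formulaDefinable_le (Sum.inr ()) (Sum.inl c)
  induction t with
  | zero => exact hfloor
  | succ t ih =>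
    intro ι e l h x c
    refine .ex (.and ?_ (.ex (.and ?_ ?_)))
    · exact hfloor (fun i => Sum.inl (e i)) (Sum.inl l) (Sum.inl h) (Sum.inl x) (Sum.inr ())
    · exact hexp.formulaDefinable_add_eq (Sum.inl (Sum.inr ())) (Sum.inr ())
        (Sum.inl (Sum.inl x))
    · exact ih (fun i => Sum.inl (Sum.inl (e i))) (Sum.inl (Sum.inl l)) (Sum.inl (Sum.inl h))
        (Sum.inr ()) (Sum.inl (Sum.inl c))

end Digits

/-! ### Representatives of Archimedean classes. -/

section Archimedean

variable {R : Type w} [AddCommGroup R] [LinearOrder R] [IsOrderedAddMonoid R]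

/-- A finite set of positive elements with at least `K` Archimedean classes contains a rapidly
decreasing sequence of `K` elements, each the greatest of its class in the set. -/
theorem exists_decreasing_representatives {Q : Set R} (hfin : Q.Finite)
    (hpos : ∀ q ∈ Q, 0 < q)
    {K : ℕ} {T : Finset (ArchimedeanClass R)} (hT : ↑T ⊆ ArchimedeanClass.mk '' Q)
    (hK : T.card = K) :
    ∃ m : ℕ → R, (∀ i < K, m i ∈ Q) ∧ (∀ i < K, ∀ q ∈ Q, q ≤ m i ∨ 2 • m i < q) ∧
      ∀ i < K, ∀ j < i, 2 • m i < m j := by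
  have hrep : ∀ γ ∈ T, ∃ q ∈ Q, ArchimedeanClass.mk q = γ ∧
      ∀ q' ∈ Q, ArchimedeanClass.mk q' = γ → q' ≤ q := by
    intro γ hγ
    obtain ⟨q₀, hq₀, hγ₀⟩ := hT hγ
    obtain ⟨q, hq, hmax⟩ := Set.exists_max_image {q ∈ Q | ArchimedeanClass.mk q = γ} id
      (hfin.subset (Set.sep_subset _ _)) ⟨q₀, hq₀, hγ₀⟩
    exact ⟨q, hq.1, hq.2, fun q' h1 h2 => hmax q' ⟨h1, h2⟩⟩
  choose! f hfQ hfγ hfmax using hrep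
  have hlt : ∀ x ∈ Q, ∀ y ∈ Q, ArchimedeanClass.mk x < ArchimedeanClass.mk y → 2 • y < x := by
    intro x hx y hy h
    have := ArchimedeanClass.mk_lt_mk.1 h 2
    rwa [abs_of_pos (hpos x hx), abs_of_pos (hpos y hy)] at this
  -- `ArchimedeanClass` is ordered in reverse, larger elements having smaller classes, so the
  -- increasing enumeration of `T` gives decreasing representatives.
  let o := T.orderEmbOfFin hK
  have hoT : ∀ i, o i ∈ T := fun i => T.orderEmbOfFin_mem hK i
  refine ⟨fun i => if h : i < K then f (o ⟨i, h⟩) else 0, fun i hi => ?_, fun i hi q hq => ?_,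
    fun i hi j hj => ?_⟩
  · simp only [hi, dif_pos]
    exact hfQ _ (hoT _)
  · simp only [hi, dif_pos]
    set γ := o ⟨i, hi⟩
    have hγ : γ ∈ T := hoT _
    rcases lt_trichotomy (ArchimedeanClass.mk q) γ with h | h | h
    · exact .inr (hlt q hq _ (hfQ _ hγ) (by rwa [hfγ _ hγ]))
    · exact .inl (hfmax _ hγ q hq h)
    · refine .inl (ArchimedeanClass.lt_of_mk_lt_mk_of_nonneg ?_ (hpos _ (hfQ _ hγ)).le).le
      rwa [hfγ _ hγ]
  · simp only [hi, hj.trans hi, dif_pos]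
    refine hlt _ (hfQ _ (hoT _)) _ (hfQ _ (hoT _)) ?_
    rw [hfγ _ (hoT _), hfγ _ (hoT _)]
    exact o.strictMono hj

end Archimedean

/-! ### Finiteness of intervals between points of a chain. -/

section Chains

variable {R : Type w} [LinearOrder R] {D : Set R} {a : R}

theorem mem_of_mem_zChain (ha : a ∈ D) {z : R} (hz : z ∈ zChain D a) : z ∈ D := by
  rcases hz with hz | hz <;> cases hz with
  | refl => exact ha
  | tail _ h => exact h.1.1

/-- Each successor or predecessor step adds just one point of `D` to the interval. -/
theorem finite_inter_uIcc_of_mem_zChain {z : R} (hz : z ∈ zChain D a) :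
    (D ∩ Set.uIcc a z).Finite := by
  rcases hz with hz | hz
  · suffices h : a ≤ z ∧ (D ∩ Set.Icc a z).Finite by rw [Set.uIcc_of_le h.1]; exact h.2
    induction hz with
    | refl => exact ⟨le_rfl, by simpa using (Set.finite_singleton a).inter_of_right D⟩
    | @tail b c _ h ih =>
      refine ⟨ih.1.trans h.1.2.le, (ih.2.insert c).subset ?_⟩
      rintro x ⟨hx, hax, hxc⟩
      rcases le_or_gt x b with hxb | hxb
      · exact .inr ⟨hx, hax, hxb⟩
      · exact .inl (le_antisymm hxc (h.2 ⟨hx, hxb⟩))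
  · suffices h : z ≤ a ∧ (D ∩ Set.Icc z a).Finite by rw [Set.uIcc_of_ge h.1]; exact h.2
    induction hz with
    | refl => exact ⟨le_rfl, by simpa using (Set.finite_singleton a).inter_of_right D⟩
    | @tail b c _ h ih =>
      refine ⟨h.1.2.le.trans ih.1, (ih.2.insert c).subset ?_⟩
      rintro x ⟨hx, hcx, hxa⟩
      rcases le_or_gt b x with hxb | hxb
      · exact .inr ⟨hx, hxb, hxa⟩
      · exact .inl (le_antisymm (h.2 ⟨hx, hxb⟩) hcx)

theorem finite_inter_Icc_of_mem_zChain {l h : R} (hl : l ∈ zChain D a) (hh : h ∈ zChain D a) :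
    (D ∩ Set.Icc l h).Finite := by
  refine ((finite_inter_uIcc_of_mem_zChain hl).union
    (finite_inter_uIcc_of_mem_zChain hh)).subset ?_
  rintro x ⟨hx, hlx, hxh⟩
  rcases le_total x a with hxa | hxa
  · exact .inl ⟨hx, Set.mem_uIcc.2 (.inr ⟨hlx, hxa⟩)⟩
  · exact .inr ⟨hx, Set.mem_uIcc.2 (.inl ⟨hxa, hxh⟩)⟩

end Chains

/-! ### Differences within an interval of `D`. -/

section Differences

variable {R : Type w} [AddCommGroup R] [LinearOrder R] {D : Set R} {a : R}

theorem intervalDifferences_mono {l l' h h' : R} (hl : l' ≤ l) (hh : h ≤ h') :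
    intervalDifferences D l h ⊆ intervalDifferences D l' h' := by
  rintro q ⟨b, ⟨hb, hlb⟩, c, ⟨hc, hch⟩, hbc⟩
  exact ⟨b, ⟨hb, hl.trans hlb⟩, c, ⟨hc, hch.trans hh⟩, hbc⟩

theorem intervalDifferences_pos [IsOrderedAddMonoid R] {l h q : R}
    (hq : q ∈ intervalDifferences D l h) : 0 < q := by
  obtain ⟨b, -, c, -, hbc, rfl⟩ := hq
  exact pos_of_lt_add_right hbc

theorem finite_intervalDifferences {l h : R} (hfin : (D ∩ Set.Icc l h).Finite) :
    (intervalDifferences D l h).Finite := by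
  refine (hfin.image2 (fun b c => c - b) hfin).subset ?_
  rintro q ⟨b, ⟨hb, hlb⟩, c, ⟨hc, hch⟩, hbc, rfl⟩
  exact ⟨b, ⟨hb, hlb, hbc.le.trans hch⟩, b + q, ⟨hc, hlb.trans hbc.le, hch⟩, by simp⟩

/-- Finitely many Archimedean classes of the differences of a `ℤ`-chain are all represented within
one interval. -/
theorem exists_classes_subset_intervalDifferences [IsOrderedAddMonoid R] (ha : a ∈ D)
    (T : Finset (ArchimedeanClass R))
    (hT : ↑T ⊆ ArchimedeanClass.mk '' differenceSet (zChain D a)) :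
    ∃ l ∈ zChain D a, ∃ h ∈ zChain D a,
      ↑T ⊆ ArchimedeanClass.mk '' intervalDifferences D l h := by
  classical
  induction T using Finset.induction_on with
  | empty => exact ⟨a, .inl .refl, a, .inl .refl, by simp⟩
  | insert γ T _ ih =>
    rw [Finset.coe_insert, Set.insert_subset_iff] at hT
    obtain ⟨l, hl, h, hh, hlh⟩ := ih hT.2
    obtain ⟨d, ⟨b, hb, c, hbc, rfl⟩, rfl⟩ := hT.1
    refine ⟨min l b, by rcases min_choice l b with e | e <;> rwa [e],
      max h c, by rcases max_choice h c with e | e <;> rw [e]; exacts [hh, hbc.1.1], ?_⟩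
    rw [Finset.coe_insert, Set.insert_subset_iff]
    refine ⟨⟨c - b, ⟨b, ⟨mem_of_mem_zChain ha hb, min_le_right _ _⟩, c,
      ⟨mem_of_mem_zChain ha hbc.1.1, le_max_right _ _⟩, hbc.1.2, by simp⟩, rfl⟩, ?_⟩
    exact hlh.trans (Set.image_mono
      (intervalDifferences_mono (min_le_left _ _) (le_max_left _ _)))

end Differences

end StrongOAG

-- Neither discreteness nor definable completeness is needed: the intervals of `D` between points of
-- a `ℤ`-chain are finite, and this is all that the argument uses.
theorem mainTheorem6 {L : FirstOrder.Language.{u, v}} {R : Type w}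
    [AddCommGroup R] [LinearOrder R] [IsOrderedAddMonoid R]
    [TopologicalSpace R] [OrderTopology R] [L.Structure R]
    (hexp : StrongOAG.IsExpansion L R)
    (hcomplete : StrongOAG.DefinablyComplete L R)
    (hstrong : StrongOAG.IsStrong.{u, v, max u v w} (L.completeTheory R))
    (D : Set R) (hdef : (Set.univ : Set R).Definable₁ L D) (hdisc : DiscreteTopology D)
    (a : R) (ha : a ∈ D) :
    (ArchimedeanClass.mk '' StrongOAG.differenceSet (StrongOAG.zChain D a)).Finite := by
  open StrongOAG in
  by_contra hinf
  obtain ⟨n, p, S, hS, hD⟩ := exists_formulaDefinable_fibre hdef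
  obtain rfl : D = {y | S p y} := Set.ext hD
  have hseq : ∀ K : ℕ, ∃ (l h : R) (m : ℕ → R),
      (∀ i < K, 0 < m i) ∧ (∀ i < K, m i ∈ intervalDifferences {y | S p y} l h) ∧
      (∀ i < K, ∀ q ∈ intervalDifferences {y | S p y} l h, q ≤ m i ∨ 2 • m i < q) ∧
      ∀ i < K, ∀ j < i, 2 • m i < m j := by
    intro K
    obtain ⟨T, hT, hK⟩ := Set.Infinite.exists_subset_card_eq hinf K
    obtain ⟨l, hl, h, hh, hlh⟩ := exists_classes_subset_intervalDifferences ha T hT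
    obtain ⟨m, h1, h2, h3⟩ := exists_decreasing_representatives
      (finite_intervalDifferences (finite_inter_Icc_of_mem_zChain hl hh))
      (fun q hq => intervalDifferences_pos hq) hlh hK
    exact ⟨l, h, m, fun i hi => intervalDifferences_pos (h1 i hi), h1, h2, h3⟩
  choose l h m hpos hmem hmax hdec using hseq
  -- The parameter tuple consists of the digit, `l`, `h`, and then the `n` parameters defining `D`.
  have hφ : ∀ t : ℕ, ∃ φ : L.Formula (Fin 1 ⊕ Fin (n + 3)), ∀ v, φ.Realize v ↔
      IsDigit (intervalDifferences {y | S (fun i => v (.inr i.succ.succ.succ)) y}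
        (v (.inr 1)) (v (.inr 2))) t (v (.inl 0)) (v (.inr 0)) := fun t =>
    formulaDefinable_isDigit hexp hS t (ι := Fin 1 ⊕ Fin (n + 3))
      (fun i => .inr i.succ.succ.succ) (.inr 1) (.inr 2) (.inl 0) (.inr 0)
  choose φ hφ using hφ
  have hindex : ∀ {N t : ℕ} (j : ℕ), t < N → t * N + min j (N - 1) < N * N := by
    intro N t j ht
    calc t * N + min j (N - 1) < t * N + N := by omega
      _ = (t + 1) * N := by ring
      _ ≤ N * N := Nat.mul_le_mul_right _ ht
  -- Row `t` uses the block of indices from `t * N` to `t * N + N - 1`. Truncating `j` at `N - 1`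
  -- keeps arbitrary paths `η` inside the block and changes nothing for `j < N`.
  refine hstrong.not_uniform_patterns φ
    (fun N t j => Fin.cons (m (N * N) (t * N + min j (N - 1)))
      (Fin.cons (l (N * N)) (Fin.cons (h (N * N)) p))) ?_ ?_
  · rintro N t j j' ht hj hj' hne ⟨x, hx, hx'⟩
    have heq : m (N * N) (t * N + min j (N - 1)) = m (N * N) (t * N + min j' (N - 1)) :=
      IsDigit.unique ((hφ t _).1 hx) ((hφ t _).1 hx')
    have hinj : ∀ {i i' : ℕ}, i < N * N → i' < i → m (N * N) i ≠ m (N * N) i' := by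
      intro i i' hi hlt he
      have h1 := hdec (N * N) i hi i' hlt
      have h2 := hpos (N * N) i hi
      rw [← he, two_nsmul] at h1
      exact absurd h1 (le_add_of_nonneg_left h2.le).not_gt
    rcases lt_or_gt_of_ne hne with hlt | hlt
    · exact hinj (hindex j' ht) (by omega) heq.symm
    · exact hinj (hindex j ht) (by omega) heq
  · intro N η
    refine ⟨fun _ => ∑ i ∈ Finset.range N, m (N * N) (i * N + min (η i) (N - 1)),
      fun t ht => (hφ t _).2 ?_⟩
    refine isDigit_sum (m := fun i => m (N * N) (i * N + min (η i) (N - 1)))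
      (fun i hi => hpos _ _ (hindex _ hi)) (fun i hi => hmem _ _ (hindex _ hi))
      (fun i hi => hmax _ _ (hindex _ hi)) (fun i hi => (hdec _ _ (hindex _ hi) _ ?_).le) ht
    have : (i + 1) * N = i * N + N := by ring
    omega
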